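/- Let $\mu$ be the Lebesgue measure on the Borel subsets of $\mathbb{R}$, and for $M\subseteq\mathbb{R}$ let $\mu_*(M)=\max\{\mu(B)\mid B\subseteq M,\ B\text{ Borel}\}$ be its inner measure. Write $\mathfrak{c}=2^{\aleph_0}$. Call $(A,A')$ a *wild pair* if $A,A'\subseteq\mathbb{R}$ are disjoint sets of cardinality $\mathfrak{c}$ such that $$\mu_*(A)=\mu_*(A')=\mu_*(\mathbb{R}\setminus A)=\mu_*(\mathbb{R}\setminus A')=0$$ and $A\cup A'$ is algebraically independent over $\mathbb{Q}$. A field $K$ has the *independence property* if there is a formula $\varphi(x_1,\dots,x_n;y_1,\dots,y_\ell)$ without parameters in the language of rings such that for every $m\in\mathbb{N}$ there are $a_1,\dots,a_m\in K^n$ and $b_J\in K^\ell$ ($J\subseteq\{1,\dots,m\}$) such that, for all $i$ and $J$, $K\models\varphi(a_i;b_J)$ if and only if $i\in J$. **Theorem.** There exists a wild pair. Moreover, for every wild pair $(A,A')$, the subfield $$K=\mathbb{Q}\bigl(\{\sqrt a\mid a\in A,\ a\ge 0\}\cup A'\bigr)\subseteq\mathbb{R}$$ has cardinality $\mathfrak{c}$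 and has the independence property; the formula $\exists y\; x=y^2$ (in the language of rings, without parameters) defines in $K$ the set $D=\{y^2\mid y\in K\}$ of its squares, so that $D$ is definable in $K$ without parameters; and $D$ does not belong to the Borel $\sigma$-algebra generated by the order topology of $K$ (for the ordering inherited from $\mathbb{R}$). In particular, there is a subfield $K$ of $\mathbb{R}$ of cardinality $\mathfrak{c}$ with the independence property that defines, without parameters in the language of rings, a set that is not Borel for the order topology on $K$. -/

import Mathlib

open scoped Cardinal FirstOrder

namespace WildField

/-- The inner measure of a set of reals: the supremum (in fact a maximum) of the Lebesgue measures
of its Borel subsets. On `ℝ` the `MeasurableSet`s are exactly the Borel sets. -/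
noncomputable def innerMeasure (M : Set ℝ) : ENNReal :=
  sSup {r | ∃ B : Set ℝ, MeasurableSet B ∧ B ⊆ M ∧ r = MeasureTheory.volume B}

/-- Two disjoint sets of reals, both of cardinality continuum, such that both sets and both of their
complements have inner measure zero, and whose union is algebraically independent over `ℚ`. -/
structure IsWildPair (A A' : Set ℝ) : Prop where
  disjoint : Disjoint A A'
  card_left : #A = 𝔠
  card_right : #A' = 𝔠
  inner_left : innerMeasure A = 0
  inner_right : innerMeasure A' = 0
  inner_compl_left : innerMeasure Aᶜ = 0
  inner_compl_right : innerMeasure A'ᶜ = 0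
  algebraicIndependent : AlgebraicIndependent ℚ (Subtype.val : ↥(A ∪ A') → ℝ)

/-- The subfield `ℚ(√(A ∩ ℝ≥0) ∪ A')` of `ℝ`. -/
noncomputable def field (A A' : Set ℝ) : Subfield ℝ :=
  (IntermediateField.adjoin ℚ (Real.sqrt '' (A ∩ Set.Ici 0) ∪ A')).toSubfield

/-- The parameter-free formula `φ(x₁,…,xₙ; y₁,…,yₗ)` has the independence property over `M`: for
every `m` there are tuples `a i` (`i < m`) and `b J` (`J ⊆ {0,…,m-1}`) such that `φ(a i; b J)` holds
in `M` exactly when `i ∈ J`. -/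
def FormulaHasIP {L : FirstOrder.Language} {n l : ℕ} (φ : L.Formula (Fin n ⊕ Fin l))
    (M : Type*) [L.Structure M] : Prop :=
  ∀ m : ℕ, ∃ (a : Fin m → Fin n → M) (b : Set (Fin m) → Fin l → M),
    ∀ (J : Set (Fin m)) (i : Fin m), φ.Realize (Sum.elim (a i) (b J)) ↔ i ∈ J

/-- A field has the independence property if some formula in the language of rings has it. -/
def HasIP (K : Type*) [Field K] : Prop :=
  letI := FirstOrder.Ring.compatibleRingOfRing K
  ∃ (n l : ℕ) (φ : FirstOrder.Language.ring.Formula (Fin n ⊕ Fin l)), FormulaHasIP φ K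

/-- The formula `φ(x)` in the language of rings, without parameters, defines `D` in the field `K`. -/
def Defines {K : Type*} [Field K] (φ : FirstOrder.Language.ring.Formula (Fin 1))
    (D : Set K) : Prop :=
  letI := FirstOrder.Ring.compatibleRingOfRing K
  ∀ x : K, φ.Realize (fun _ => x) ↔ x ∈ D

/-- `D` is definable in the field `K` by a formula in the language of rings without parameters. -/
def EmptyDefinable {K : Type*} [Field K] (D : Set K) : Prop :=
  letI := FirstOrder.Ring.compatibleRingOfRing K
  (∅ : Set K).Definable₁ FirstOrder.Language.ring D

/-- The formula `∃ y, x = y * y` in the language of rings, with free variable `x`. -/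
def squareFormula : FirstOrder.Language.ring.Formula (Fin 1) :=
  ∃' ((FirstOrder.Language.Term.var (Sum.inl 0) :
    FirstOrder.Language.ring.Term (Fin 1 ⊕ Fin 1)) =' (&0 * &0))

/-- The set of squares of `K`. -/
def squares (K : Type*) [Field K] : Set K := {x | ∃ y : K, x = y ^ 2}

/-- `D` belongs to the Borel σ-algebra generated by the order topology of `X`. -/
def IsOrderBorel {X : Type*} [LinearOrder X] (D : Set X) : Prop :=
  @MeasurableSet X (@borel X (Preorder.topology X)) D

end WildField

/-! For fixed `x`, the values of `N(u) - x N(v)`, with `N` the quaternion norm, are closed under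
products (`Represents.mul`). Put `c i = (s - 4i)^2 - 1`, negative exactly for `s` within 1 of `4i`.
As these intervals are far apart, `c i` represents `c j` for `j ≠ i` (`represents_sub_sq`), hence
any product of such `c j`. A product containing `c i` once is not represented if some real embedding
moves `s` near `4i`: there `c i` and the product are negative, but the form is nonnegative. This
gives the independence property.

Such embeddings exist for `s = t ∈ A'`: `t` is transcendental over a field containing the other
generators, so `t ↦ t + q` extends to `K` (`IsWildPair.exists_ringHom_eq_add`). Making `t + q`
negative shows that `t` is not a square, while nonnegative elements of `A` are squares. So a Borel
trace `B` of the squares misses `A'`, and `[0, ∞) \ B` misses `A`; both are null, which is absurd.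
-/

namespace WildField

/-! ### The quaternionic form and its values -/

open Quaternion

/-- `y` is represented by the form `N(u) - x N(v)`, where `N` is the quaternion norm. -/
def Represents {K : Type*} [Field K] (x y : K) : Prop :=
  ∃ u v : ℍ[K], y = normSq u - x * normSq v

theorem represents_one {K : Type*} [Field K] (x : K) : Represents x 1 :=
  ⟨1, 0, by simp⟩

/-- The form is the octonion norm obtained by Cayley–Dickson doubling with parameter `x`; the
witnesses are the octonion product. -/
theorem Represents.mul {K : Type*} [Field K] {x y z : K} (hy : Represents x y)
    (hz : Represents x z) : Represents x (y * z) := by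
  obtain ⟨a, b, rfl⟩ := hy
  obtain ⟨c, d, rfl⟩ := hz
  refine ⟨a * c + x • (star d * b), d * a + b * star c, ?_⟩
  simp only [normSq_def', re_add, imI_add, imJ_add, imK_add, re_mul, imI_mul, imJ_mul,
    imK_mul, re_smul, imI_smul, imJ_smul, imK_smul, re_star, imI_star, imJ_star, imK_star,
    smul_eq_mul]
  ring

theorem exists_normSq_eq {K : Type*} [Field K] (a b c d : K) :
    ∃ u : ℍ[K], normSq u = a ^ 2 + b ^ 2 + c ^ 2 + d ^ 2 :=
  ⟨(⟨a, b, c, d⟩ : QuaternionAlgebra K (-1) 0 (-1)), normSq_def' _⟩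

theorem exists_normSq_eq_ratCast {K : Type*} [Field K] [CharZero K] {q : ℚ} (hq : 0 ≤ q) :
    ∃ u : ℍ[K], normSq u = q := by
  obtain ⟨a, b, c, d, h⟩ := Nat.sum_four_squares (q.num.toNat * q.den)
  obtain ⟨u, hu⟩ := exists_normSq_eq (a / q.den : K) (b / q.den) (c / q.den) (d / q.den)
  refine ⟨u, ?_⟩
  have hd : (q.den : K) ≠ 0 := by exact_mod_cast q.den_ne_zero
  have hn : ((q.num.toNat : ℤ)) = q.num := Int.toNat_of_nonneg (Rat.num_nonneg.2 hq)
  have h' : (a : K) ^ 2 + b ^ 2 + c ^ 2 + d ^ 2 = (q.num : K) * q.den := by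
    rw [← hn]; exact_mod_cast h
  rw [hu, Rat.cast_def]
  field_simp
  linear_combination h'

/-- A weighted mean of the two polynomials, with weights `1/2 - t` at `p` and `1/2 + t` at `r`, is a
square plus the constant `(1/4 - t^2)(p - r)^2 - 1`. If that constant is a sum of three squares, the
mean is a quaternion norm, and solving for the second polynomial gives the representation. -/
theorem represents_sub_sq {K : Type*} [Field K] [CharZero K] (s : K) {p r : ℚ}
    (h : 4 < (p - r) ^ 2) :
    Represents ((s - p) ^ 2 - 1) ((s - r) ^ 2 - 1) := by
  obtain ⟨w, hw⟩ := exists_normSq_eq_ratCast (K := ℚ) (q := (p - r) ^ 2 / 4 - 1) (by linarith)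
  rw [normSq_def', Rat.cast_id] at hw
  obtain ⟨y, z₁, z₂, z₃⟩ := w
  dsimp only at hw
  have hy : y ^ 2 < ((p - r) / 2) ^ 2 := by
    nlinarith [sq_nonneg z₁, sq_nonneg z₂, sq_nonneg z₃]
  have hΔ : p - r ≠ 0 := by rintro h0; rw [h0] at h; norm_num at h
  -- Lagrange gives four squares; this choice of weight absorbs `y^2`, leaving a slot of `u` for the
  -- square involving `s`.
  obtain ⟨t, ht⟩ : ∃ t : ℚ, t * (p - r) = y := ⟨y / (p - r), by field_simp⟩
  have ht2 : t ^ 2 < 1 / 4 := by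
    rw [← ht] at hy
    have : 0 < (p - r) ^ 2 := by positivity
    by_contra! hc
    nlinarith
  have ht3 := abs_lt.1 (abs_lt_of_sq_lt_sq (by linarith : t ^ 2 < (1 / 2) ^ 2) (by norm_num))
  have hw0 : 0 < 1 / 2 + t := by linarith
  have hw1 : 0 < 1 / 2 - t := by linarith
  obtain ⟨n, hn⟩ := exists_normSq_eq_ratCast (K := K) (q := 1 / (1 / 2 + t)) (by positivity)
  obtain ⟨n', hn'⟩ := exists_normSq_eq_ratCast (K := K) (q := (1 / 2 - t) / (1 / 2 + t))
    (by positivity)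
  obtain ⟨u, hu⟩ := exists_normSq_eq (s - ((1 / 2 - t) * p + (1 / 2 + t) * r : ℚ)) (z₁ : K) z₂ z₃
  refine ⟨n * u, n', ?_⟩
  rw [map_mul, hn, hn', hu]
  have hwK : ((1 / 2 + t : ℚ) : K) ≠ 0 := by exact_mod_cast hw0.ne'
  have key : (((t * (p - r)) ^ 2 + z₁ ^ 2 + z₂ ^ 2 + z₃ ^ 2 : ℚ) : K) =
      ((p - r) ^ 2 / 4 - 1 : ℚ) := by
    rw [ht, hw]
  rw [Rat.cast_div, Rat.cast_div]
  push_cast at key hwK ⊢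
  have hwK' : (1 : K) + 2 * t ≠ 0 := by
    intro h0; apply hwK; linear_combination h0 / 2
  field_simp
  linear_combination (-4 : K) * key

theorem not_represents_of_neg {K : Type*} [Field K] (f : K →+* ℝ) {x y : K} (hx : f x < 0)
    (hy : f y < 0) : ¬ Represents x y := by
  rintro ⟨u, v, rfl⟩
  simp only [normSq_def', map_sub, map_mul, map_add, map_pow] at hy
  nlinarith [sq_nonneg (f u.re), sq_nonneg (f u.imI), sq_nonneg (f u.imJ), sq_nonneg (f u.imK),
    mul_nonneg (neg_nonneg.2 hx.le) (sq_nonneg (f v.re)),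
    mul_nonneg (neg_nonneg.2 hx.le) (sq_nonneg (f v.imI)),
    mul_nonneg (neg_nonneg.2 hx.le) (sq_nonneg (f v.imJ)),
    mul_nonneg (neg_nonneg.2 hx.le) (sq_nonneg (f v.imK))]

/-! ### Formulas and the independence property -/

open FirstOrder FirstOrder.Language

/-- The formula in `x` and `y` that says `Represents x y`. -/
noncomputable def representsFormula : ring.Formula (Fin 1 ⊕ Fin 1) :=
  Formula.iExs (Fin 4 ⊕ Fin 4)
    (Term.equal
      ((Term.var (Sum.inl (Sum.inr 0)) : ring.Term ((Fin 1 ⊕ Fin 1) ⊕ (Fin 4 ⊕ Fin 4))) +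
        Term.var (Sum.inl (Sum.inl 0)) *
          (Term.var (Sum.inr (Sum.inr 0)) * Term.var (Sum.inr (Sum.inr 0)) +
            Term.var (Sum.inr (Sum.inr 1)) * Term.var (Sum.inr (Sum.inr 1)) +
            Term.var (Sum.inr (Sum.inr 2)) * Term.var (Sum.inr (Sum.inr 2)) +
            Term.var (Sum.inr (Sum.inr 3)) * Term.var (Sum.inr (Sum.inr 3))))
      (Term.var (Sum.inr (Sum.inl 0)) * Term.var (Sum.inr (Sum.inl 0)) +
        Term.var (Sum.inr (Sum.inl 1)) * Term.var (Sum.inr (Sum.inl 1)) +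
        Term.var (Sum.inr (Sum.inl 2)) * Term.var (Sum.inr (Sum.inl 2)) +
        Term.var (Sum.inr (Sum.inl 3)) * Term.var (Sum.inr (Sum.inl 3))))

theorem realize_representsFormula {K : Type*} [Field K] [FirstOrder.Ring.CompatibleRing K]
    (a b : Fin 1 → K) :
    representsFormula.Realize (Sum.elim a b) ↔ Represents (a 0) (b 0) := by
  simp only [representsFormula, Formula.realize_iExs, Formula.realize_equal,
    FirstOrder.Ring.realize_add, FirstOrder.Ring.realize_mul, Term.realize_var, Sum.elim_inl,
    Sum.elim_inr]
  constructor
  · rintro ⟨i, hi⟩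
    obtain ⟨u, hu⟩ := exists_normSq_eq (i (.inl 0)) (i (.inl 1)) (i (.inl 2)) (i (.inl 3))
    obtain ⟨v, hv⟩ := exists_normSq_eq (i (.inr 0)) (i (.inr 1)) (i (.inr 2)) (i (.inr 3))
    refine ⟨u, v, ?_⟩
    rw [hu, hv]
    linear_combination hi
  · rintro ⟨u, v, h⟩
    refine ⟨Sum.elim ![u.re, u.imI, u.imJ, u.imK] ![v.re, v.imI, v.imJ, v.imK], ?_⟩
    simp [h, normSq_def']
    ring

theorem hasIP_of_forall_exists_ringHom {K : Type*} [Field K] [CharZero K] (s : K)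
    (hs : ∀ n : ℕ, ∃ f : K →+* ℝ, |f s - 4 * n| < 1) : HasIP K := by
  classical
  let _ := FirstOrder.Ring.compatibleRingOfRing K
  refine ⟨1, 1, representsFormula, fun m => ?_⟩
  let c : ℕ → K := fun i => (s - ((4 * i : ℕ) : ℚ)) ^ 2 - 1
  refine ⟨fun i _ => c i, fun J _ => ∏ j with j ∉ J, c j, fun J i => ?_⟩
  rw [realize_representsFormula]
  constructor
  · contrapose
    intro hi
    obtain ⟨f, hf⟩ := hs i
    have hfc (j : Fin m) : f (c j) = (f s - 4 * (j : ℕ)) ^ 2 - 1 := by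
      simp [c, map_ofNat]
    have hneg : f (c i) < 0 := by
      rw [hfc, sub_neg]
      exact (sq_lt_one_iff_abs_lt_one _).2 hf
    refine not_represents_of_neg f hneg ?_
    rw [map_prod, ← Finset.mul_prod_erase _ _ (a := i) (by simpa using hi)]
    refine mul_neg_of_neg_of_pos hneg (Finset.prod_pos fun j hj => ?_)
    have hji : j ≠ i := Finset.ne_of_mem_erase hj
    rw [hfc, sub_pos, one_lt_sq_iff_one_lt_abs]
    have h1 : (1 : ℝ) ≤ |((i : ℕ) : ℝ) - (j : ℕ)| := by
      have : (1 : ℤ) ≤ |((i : ℕ) : ℤ) - (j : ℕ)| := by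
        refine Int.one_le_abs (sub_ne_zero.2 ?_)
        exact_mod_cast fun h : (i : ℕ) = j => hji (Fin.ext h.symm)
      exact_mod_cast this
    have h2 := abs_sub_abs_le_abs_sub (4 * (((i : ℕ) : ℝ) - (j : ℕ))) (4 * (i : ℕ) - f s)
    rw [abs_mul, abs_of_pos (by norm_num : (0 : ℝ) < 4), abs_sub_comm _ (f s)] at h2
    have h3 : 4 * (((i : ℕ) : ℝ) - (j : ℕ)) - (4 * (i : ℕ) - f s) = f s - 4 * (j : ℕ) := by ring
    rw [h3] at h2
    linarith
  · intro hi
    refine Finset.prod_induction _ (Represents (c i)) (fun _ _ => .mul) (represents_one _)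
      fun j hj => represents_sub_sq s ?_
    have hji : (i : ℕ) ≠ j := by
      rintro h
      exact (Finset.mem_filter.1 hj).2 (Fin.ext h ▸ hi)
    have : (1 : ℤ) ≤ (((i : ℕ) : ℤ) - (j : ℕ)) ^ 2 := by
      have : ((i : ℕ) : ℤ) - (j : ℕ) ≠ 0 := sub_ne_zero.2 (by exact_mod_cast hji)
      have := sq_pos_of_ne_zero this
      omega
    have : (1 : ℚ) ≤ (((i : ℕ) : ℚ) - (j : ℕ)) ^ 2 := by exact_mod_cast this
    push_cast
    linarith

theorem defines_squareFormula (K : Type*) [Field K] : Defines squareFormula (squares K) := by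
  let _ := FirstOrder.Ring.compatibleRingOfRing K
  intro x
  simp [squareFormula, squares, Formula.Realize, Fin.snoc, sq]

theorem Defines.emptyDefinable {K : Type*} [Field K] {φ : ring.Formula (Fin 1)} {D : Set K}
    (h : Defines φ D) : EmptyDefinable D := by
  let _ := FirstOrder.Ring.compatibleRingOfRing K
  refine Set.Definable.mono (A := ∅) ?_ (Set.Subset.refl _)
  rw [Set.empty_definable_iff]
  refine ⟨φ, ?_⟩
  ext v
  rw [Set.mem_ofPred_eq, Set.mem_ofPred_eq, ← h (v 0)]
  exact iff_of_eq (congrArg _ (funext fun i => by rw [Subsingleton.elim i 0]))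

/-! ### Translating an element of `A'` -/

open IntermediateField

theorem exists_algHom_gen_eq_add {F E : Type*} [Field F] [Field E] [Algebra F E] {t : E}
    (ht : Transcendental F t) (c : F) :
    ∃ f : F⟮t⟯ →ₐ[F] E, f (AdjoinSimple.gen F t) = t + algebraMap F E c := by
  have ht' : Transcendental F (t + algebraMap F E c) := by
    have := ht.aeval (Polynomial.X + Polynomial.C c) (by simp)
    rw [map_add, Polynomial.aeval_X, Polynomial.aeval_C] at this
    exact this (by simp)
  refine ⟨F⟮t + algebraMap F E c⟯.val.comp
    ((RatFunc.algEquivOfTranscendental _ ht').toAlgHom.comp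
      (RatFunc.algEquivOfTranscendental t ht).symm.toAlgHom), ?_⟩
  simp

theorem mem_field_of_mem_right {A A' : Set ℝ} {t : ℝ} (ht : t ∈ A') : t ∈ field A A' :=
  subset_adjoin ℚ _ (Or.inr ht)

theorem sqrt_mem_field {A A' : Set ℝ} {a : ℝ} (ha : a ∈ A) (h0 : 0 ≤ a) : √a ∈ field A A' :=
  subset_adjoin ℚ _ (Or.inl ⟨a, ⟨ha, h0⟩, rfl⟩)

theorem IsWildPair.exists_ringHom_eq_add {A A' : Set ℝ} (h : IsWildPair A A') {t : ℝ}
    (ht : t ∈ A') (q : ℚ) :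
    ∃ f : field A A' →+* ℝ, f ⟨t, mem_field_of_mem_right ht⟩ = t + q := by
  let S : Set ℝ := (A ∪ A') \ {t}
  let E := IntermediateField.adjoin ℚ S
  have htE : Transcendental E t := by
    have hS : S = Subtype.val '' {i : ↥(A ∪ A') | (i : ℝ) ≠ t} := by
      ext x
      simp only [S, Set.mem_image, Set.mem_sdiff, Set.mem_singleton_iff]
      exact ⟨fun hx => ⟨⟨x, hx.1⟩, hx.2, rfl⟩, by rintro ⟨y, hy, rfl⟩; exact ⟨y.2, hy⟩⟩
    rw [transcendental_adjoin_iff, hS]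
    exact h.algebraicIndependent.transcendental_adjoin
      (s := {i | (i : ℝ) ≠ t}) (i := ⟨t, Or.inr ht⟩) (by simp)
  -- Passing to the algebraic closure in `ℝ` brings in the square roots and keeps `t`
  -- transcendental.
  let F := algebraicClosure E ℝ
  have htF : Transcendental F t := htE.extendScalars _
  obtain ⟨f, hf⟩ := exists_algHom_gen_eq_add htF (q : F)
  have hSE {x : ℝ} (hx : x ∈ S) : x ∈ E := subset_adjoin ℚ S hx
  have hF {x : ℝ} (hx : x ∈ F) : x ∈ F⟮t⟯ := F⟮t⟯.algebraMap_mem ⟨x, hx⟩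
  have hle : IntermediateField.adjoin ℚ (Real.sqrt '' (A ∩ Set.Ici 0) ∪ A') ≤
      F⟮t⟯.restrictScalars ℚ := by
    refine adjoin_le_iff.2 ?_
    rintro _ (⟨a, ⟨ha, h0⟩, rfl⟩ | hb)
    · refine hF (mem_algebraicClosure_iff.2 (IsAlgebraic.of_pow two_pos ?_))
      have hat : a ≠ t := fun hat => Set.disjoint_left.1 h.disjoint ha (hat ▸ ht)
      rw [Real.sq_sqrt h0]
      exact isAlgebraic_algebraMap (⟨a, hSE ⟨Or.inl ha, hat⟩⟩ : E)
    · rename_i b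
      by_cases hbt : b = t
      · rw [hbt]
        exact mem_adjoin_simple_self F t
      · exact hF (mem_algebraicClosure_iff.2
          (isAlgebraic_algebraMap (⟨b, hSE ⟨Or.inr hb, hbt⟩⟩ : E)))
  refine ⟨(f : F⟮t⟯ →+* ℝ).comp (Subfield.inclusion (T := F⟮t⟯.toSubfield) hle), ?_⟩
  change f (AdjoinSimple.gen F t) = _
  rw [hf]
  simp

theorem IsWildPair.nonempty_right {A A' : Set ℝ} (h : IsWildPair A A') : A'.Nonempty := by
  rw [Set.nonempty_iff_ne_empty]
  rintro rfl
  exact Cardinal.continuum_ne_zero (by simpa using h.card_right.symm)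

theorem IsWildPair.mk_field {A A' : Set ℝ} (h : IsWildPair A A') : #(field A A') = 𝔠 :=
  le_antisymm (Cardinal.mk_real ▸ Cardinal.mk_subtype_le _)
    (h.card_right ▸ Cardinal.mk_le_mk_of_subset fun _ => mem_field_of_mem_right)

theorem IsWildPair.hasIP {A A' : Set ℝ} (h : IsWildPair A A') : HasIP (field A A') := by
  obtain ⟨t, ht⟩ := h.nonempty_right
  refine hasIP_of_forall_exists_ringHom ⟨t, mem_field_of_mem_right ht⟩ fun n => ?_
  obtain ⟨q, hq⟩ := exists_rat_btwn (show 4 * (n : ℝ) - t - 1 < 4 * n - t + 1 by linarith)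
  obtain ⟨f, hf⟩ := h.exists_ringHom_eq_add ht q
  refine ⟨f, ?_⟩
  rw [hf, abs_lt]
  constructor <;> linarith

theorem IsWildPair.notMem_squares {A A' : Set ℝ} (h : IsWildPair A A') {t : ℝ} (ht : t ∈ A') :
    (⟨t, mem_field_of_mem_right ht⟩ : field A A') ∉ squares (field A A') := by
  rintro ⟨y, hy⟩
  obtain ⟨q, hq⟩ := exists_rat_lt (-t)
  obtain ⟨f, hf⟩ := h.exists_ringHom_eq_add ht q
  rw [hy, map_pow] at hf
  nlinarith [sq_nonneg (f y)]

/-! ### The squares are not Borel -/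

/-- On a subfield of `ℝ`, the order topology is the subspace topology. -/
theorem _root_.Subfield.orderTopology_real (K : Subfield ℝ) : OrderTopology K :=
  induced_orderTopology _ Iff.rfl fun {x y} h =>
    let ⟨q, hq⟩ := exists_rat_btwn h
    ⟨q, by simpa using hq⟩

theorem IsOrderBorel.exists_measurableSet {K : Subfield ℝ} {D : Set K} (hD : IsOrderBorel D) :
    ∃ B : Set ℝ, MeasurableSet B ∧ Subtype.val ⁻¹' B = D := by
  have := K.orderTopology_real
  rw [IsOrderBorel, ← OrderTopology.topology_eq_generate_intervals] at hD
  have hK := borel_comap (f := (Subtype.val : K → ℝ)) (t := inferInstance)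
  rw [← BorelSpace.measurable_eq (α := ℝ)] at hK
  change @MeasurableSet K (@borel K (TopologicalSpace.induced Subtype.val _)) D at hD
  rw [hK] at hD
  exact hD

theorem volume_eq_zero_of_innerMeasure_eq_zero {M B : Set ℝ} (hM : innerMeasure M = 0)
    (hB : MeasurableSet B) (hBM : B ⊆ M) : MeasureTheory.volume B = 0 :=
  le_antisymm (hM ▸ le_sSup ⟨B, hB, hBM, rfl⟩) zero_le

theorem IsWildPair.not_isOrderBorel_squares {A A' : Set ℝ} (h : IsWildPair A A') :
    ¬ IsOrderBorel (squares (field A A')) := by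
  intro hD
  obtain ⟨B, hB, hBD⟩ := hD.exists_measurableSet
  have h1 : MeasureTheory.volume B = 0 := by
    refine volume_eq_zero_of_innerMeasure_eq_zero h.inner_compl_right hB fun x hx hx' => ?_
    refine h.notMem_squares hx' ?_
    rw [← hBD]
    exact hx
  have h2 : MeasureTheory.volume (Set.Ici 0 \ B) = 0 := by
    refine volume_eq_zero_of_innerMeasure_eq_zero h.inner_compl_left
      (measurableSet_Ici.diff hB) fun x hx hx' => hx.2 ?_
    have : (⟨√x, sqrt_mem_field hx' hx.1⟩ : field A A') ^ 2 ∈ Subtype.val ⁻¹' B := by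
      rw [hBD]
      exact ⟨_, rfl⟩
    simpa [Real.sq_sqrt (Set.mem_Ici.1 hx.1)] using this
  have h3 : MeasureTheory.volume (Set.Ici (0 : ℝ)) = 0 :=
    MeasureTheory.measure_mono_null (t := B ∪ Set.Ici 0 \ B) (by simp)
      (MeasureTheory.measure_union_null h1 h2)
  simp at h3

/-! ### Existence of wild pairs by transfinite recursion -/

theorem exists_mem_transcendental_adjoin {C S : Set ℝ} (hC : #C = 𝔠) (hS : #S < 𝔠) :
    ∃ y ∈ C, Transcendental (Algebra.adjoin ℚ S) y := by
  by_contra! hc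
  have hR : #(Algebra.adjoin ℚ S) < 𝔠 := by
    refine (Algebra.cardinalMk_adjoin_le ℚ S).trans_lt ?_
    simp [hS, Cardinal.aleph0_lt_continuum]
  refine hC.not_lt ((Cardinal.mk_le_mk_of_subset fun y hy => not_not.1 (hc y hy)).trans_lt
    ((Algebraic.cardinalMk_le_max (Algebra.adjoin ℚ S) ℝ).trans_lt ?_))
  exact max_lt hR Cardinal.aleph0_lt_continuum

theorem _root_.algebraicIndependent_of_transcendental_adjoin_Iio {ι R A : Type*} [LinearOrder ι]
    [CommRing R] [CommRing A] [Algebra R A] {x : ι → A}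
    (hinj : Function.Injective (algebraMap R A))
    (h : ∀ i, Transcendental (Algebra.adjoin R (x '' Set.Iio i)) (x i)) :
    AlgebraicIndependent R x := by
  refine algebraicIndependent_of_finite_type fun t ht => ?_
  obtain ⟨t, rfl⟩ := ht.exists_finset_coe
  change AlgebraicIndepOn R x (t : Set ι)
  induction t using Finset.induction_on_max with
  | empty => simpa [AlgebraicIndepOn] using hinj
  | insert a s hs ih =>
    rw [Finset.coe_insert]
    exact (ih s.finite_toSet).insert ((h a).of_tower_top_of_subalgebra_le
      (Algebra.adjoin_mono (Set.image_mono hs)))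

theorem exists_algebraicIndependent_forall_mem {ι : Type} (hι : #ι ≤ 𝔠) {C : ι → Set ℝ}
    (hC : ∀ i, #(C i) = 𝔠) :
    ∃ x : ι → ℝ, (∀ i, x i ∈ C i) ∧ AlgebraicIndependent ℚ x := by
  -- With the least possible order type, proper initial segments have fewer than `𝔠` elements, so a
  -- transcendental choice remains at each stage.
  obtain ⟨_, _, hord⟩ := Cardinal.exists_ord_eq_type_lt ι
  have key (i : ι) (g : Set.Iio i → ℝ) :
      ∃ y ∈ C i, Transcendental (Algebra.adjoin ℚ (Set.range g)) y :=
    exists_mem_transcendental_adjoin (hC i)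
      (Cardinal.mk_range_le.trans_lt ((Cardinal.mk_Iio_lt i hord).trans_le hι))
  choose g hgC hg using key
  let x : ι → ℝ := wellFounded_lt.fix fun i ih => g i fun j => ih j j.2
  have hx (i : ι) : x i = g i fun j => x j := wellFounded_lt.fix_eq _ i
  refine ⟨x, fun i => hx i ▸ hgC _ _,
    algebraicIndependent_of_transcendental_adjoin_Iio (algebraMap ℚ ℝ).injective fun i => ?_⟩
  rw [hx i, Set.image_eq_range]
  exact hg _ _

theorem mk_eq_continuum_of_volume_ne_zero {B : Set ℝ} (hB : MeasurableSet B)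
    (h : MeasureTheory.volume B ≠ 0) : #B = 𝔠 := by
  have := hB.standardBorel
  have hc : ¬ Countable B := fun hc => h (Set.Countable.measure_zero hc _)
  have hr : ¬ Countable ℝ := not_countable
  rw [← Cardinal.mk_real]
  exact Cardinal.mk_congr (PolishSpace.measurableEquivOfNotCountable hc hr).toEquiv

theorem mk_measurableSet_le_continuum : #{B : Set ℝ // MeasurableSet B} ≤ 𝔠 := by
  rw [BorelSpace.measurable_eq (α := ℝ), Real.borel_eq_generateFrom_Ioo_rat]
  refine MeasurableSpace.cardinal_measurableSet_le_continuum
    (((Set.Countable.le_aleph0 ?_)).trans Cardinal.aleph0_le_continuum)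
  exact Set.countable_iUnion fun _ => Set.countable_iUnion fun _ => Set.countable_iUnion fun _ =>
    Set.countable_singleton _

theorem innerMeasure_eq_zero {M : Set ℝ}
    (h : ∀ B, MeasurableSet B → MeasureTheory.volume B ≠ 0 → ∃ x ∈ B, x ∉ M) :
    innerMeasure M = 0 := by
  refine sSup_eq_bot.2 ?_
  rintro _ ⟨B, hB, hBM, rfl⟩
  by_contra hv
  obtain ⟨x, hx, hxM⟩ := h B hB hv
  exact hxM (hBM hx)

theorem exists_isWildPair : ∃ A A' : Set ℝ, IsWildPair A A' := by
  let P := {B : Set ℝ // MeasurableSet B ∧ MeasureTheory.volume B ≠ 0}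
  have hP : #P ≤ 𝔠 :=
    (Cardinal.mk_subtype_mono fun _ h => h.1).trans mk_measurableSet_le_continuum
  have hP' : 𝔠 ≤ #P := by
    rw [← Cardinal.mk_real]
    refine Cardinal.mk_le_of_injective (f := fun x : ℝ => (⟨Set.Ioi x, measurableSet_Ioi,
      by simp⟩ : P)) fun x y hxy => ?_
    exact Set.Ioi_injective (congrArg Subtype.val hxy)
  -- The Boolean makes both sets meet every Borel set of positive measure.
  have hι : #(P × Bool) ≤ 𝔠 := by
    rw [Cardinal.mk_prod, Cardinal.lift_id, Cardinal.lift_id]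
    refine (mul_le_mul' hP (Cardinal.mk_le_aleph0.trans Cardinal.aleph0_le_continuum)).trans ?_
    rw [Cardinal.continuum_mul_self]
  obtain ⟨x, hxC, hx⟩ := exists_algebraicIndependent_forall_mem hι
    (C := fun i => i.1.1) fun i => mk_eq_continuum_of_volume_ne_zero i.1.2.1 i.1.2.2
  have hinj : Function.Injective x := hx.injective
  have hcard (b : Bool) : #(Set.range fun B : P => x (B, b)) = 𝔠 := by
    rw [Cardinal.mk_range_eq _ fun B B' h => (Prod.ext_iff.1 (hinj h)).1]
    exact le_antisymm hP hP'
  have hdisj : Disjoint (Set.range fun B : P => x (B, false))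
      (Set.range fun B : P => x (B, true)) := by
    rw [Set.disjoint_left]
    rintro _ ⟨B, rfl⟩ ⟨B', h⟩
    simpa using hinj h
  refine ⟨Set.range fun B : P => x (B, false), Set.range fun B : P => x (B, true),
    hdisj, hcard _, hcard _,
    innerMeasure_eq_zero fun B hB hv => ⟨x (⟨B, hB, hv⟩, true), hxC (⟨B, hB, hv⟩, true),
      Set.disjoint_right.1 hdisj ⟨_, rfl⟩⟩,
    innerMeasure_eq_zero fun B hB hv => ⟨x (⟨B, hB, hv⟩, false), hxC (⟨B, hB, hv⟩, false),
      Set.disjoint_left.1 hdisj ⟨_, rfl⟩⟩,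
    innerMeasure_eq_zero fun B hB hv => ⟨x (⟨B, hB, hv⟩, false), hxC (⟨B, hB, hv⟩, false),
      fun h => h ⟨_, rfl⟩⟩,
    innerMeasure_eq_zero fun B hB hv => ⟨x (⟨B, hB, hv⟩, true), hxC (⟨B, hB, hv⟩, true),
      fun h => h ⟨_, rfl⟩⟩, ?_⟩
  have hsub : (Set.range fun B : P => x (B, false)) ∪ (Set.range fun B : P => x (B, true)) ⊆
      Set.range x := by
    rintro _ (⟨B, rfl⟩ | ⟨B, rfl⟩) <;> exact ⟨_, rfl⟩
  exact hx.coe_range.mono hsub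

end WildField

theorem theorem3p3 :
    (∃ A A' : Set ℝ, WildField.IsWildPair A A') ∧
    ∀ A A' : Set ℝ, WildField.IsWildPair A A' →
      #(WildField.field A A') = 𝔠 ∧
      WildField.HasIP (WildField.field A A') ∧
      WildField.Defines WildField.squareFormula (WildField.squares (WildField.field A A')) ∧
      WildField.EmptyDefinable (WildField.squares (WildField.field A A')) ∧
      ¬ WildField.IsOrderBorel (WildField.squares (WildField.field A A')) :=
  ⟨WildField.exists_isWildPair, fun _ _ h =>
    ⟨h.mk_field, h.hasIP, WildField.defines_squareFormula _,
      (WildField.defines_squareFormula _).emptyDefinable, h.not_isOrderBorel_squares⟩⟩
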